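/- A hypergraph here has finite sets of vertices, edges and hinges; each hinge attaches one edge to one vertex, and every edge has at least one hinge. The degree $d(v)$ of a vertex $v$ is the number of hinges at $v$, the size of an edge is the number of distinct vertices incident with it, and the multiplicity of a set $U$ of vertices is the number of edges that are attached by exactly one hinge to each vertex of $U$ and by no hinge to any other vertex. Let $n\ge 1$, let $R=[r_1\dots r_k]^T$, $\Lambda=[\lambda_1\dots\lambda_m]^T$, $H=[h_1\dots h_m]^T$ be column vectors of positive integers with $h_1,\dots,h_m$ distinct and $1\le h_j\le n$, let $s(\cdot)$ denote the sum of all entries of a matrix, let $J_k=[1\dots1]^T$ have $k$ entries, and compare vectors entrywise. Let $\Lambda K_n^H$ be the hypergraph on $n$ vertices in which no edge is attached to a vertex by more than one hinge, every edge has one of the sizes $h_1,\dots,h_m$, and every set of $h_j$ vertices has multiplicity $\lambda_j$ $(1\le j\le m)$. It is called almost $R$-factorizable if its edge set is a union of pairwise disjoint sets $F_1,\dots,F_k$ (possibly empty) such that for every $i$ the spanning sub-hypergraph consisting of all vertices and the edges in $F_i$ (with all their hinges) satisfies $r_i-1\le d(v)\le r_i$ for every vertex $v$. Theorem. $\Lambda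 K_n^H$ is almost $R$-factorizable if and only if $$s(R)-k\le \sum_{j=1}^m\lambda_j\binom{n-1}{h_j-1}\le s(R),$$ and there exists a non-negative integer matrix $A=[a_{ij}]_{k\times m}$ such that $$n(R-J_k)\le AH\le nR\quad\text{and}\quad \sum_{i=1}^k a_{ij}=\lambda_j\binom{n}{h_j}\ \text{ for } 1\le j\le m.$$ -/

import Mathlib

/-- A hypergraph with vertices `V`, edges `E` and hinges `K`. Each hinge `x` attaches the edge
`edge x` to the vertex `vert x`, and every edge has at least one hinge. Several hinges may attach
the same edge to the same vertex, and several edges may join the same vertices.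
Finiteness of `V`, `E`, `K` is assumed where the structure is used. -/
structure HingeHypergraph (V E K : Type*) where
  /-- the vertex of a hinge -/
  vert : K → V
  /-- the edge of a hinge -/
  edge : K → E
  edge_surjective : Function.Surjective edge

namespace HingeHypergraph

variable {V E K : Type*}

/-- The degree of a vertex: the number of hinges incident with it. -/
noncomputable def degree (G : HingeHypergraph V E K) (v : V) : ℕ :=
  Nat.card {x : K // G.vert x = v}

/-- The number of hinges incident with both the vertex `v` and the edge `e`. -/
noncomputable def hingeCount (G : HingeHypergraph V E K) (v : V) (e : E) : ℕ :=
  Nat.card {x : K // G.vert x = v ∧ G.edge x = e}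

/-- The size of an edge: the number of distinct vertices incident with it. -/
noncomputable def size (G : HingeHypergraph V E K) (e : E) : ℕ :=
  Nat.card {v : V // ∃ x : K, G.vert x = v ∧ G.edge x = e}

/-- No edge is attached to the same vertex by more than one hinge (multiple edges are allowed). -/
def IsSimple (G : HingeHypergraph V E K) : Prop :=
  ∀ v e, G.hingeCount v e ≤ 1

open Classical in
/-- The multiplicity of a multiset `U` of vertices: the number of edges `e` that are attached to
each vertex `v` by exactly as many hinges as the multiplicity of `v` in `U`. -/
noncomputable def multiplicity (G : HingeHypergraph V E K) (U : Multiset V) : ℕ :=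
  Nat.card {e : E // ∀ v, G.hingeCount v e = U.count v}

/-- `G` is the hypergraph `Λ K_n^H`, where `n` is the number of vertices,
`Λ = (lam j)` and `H = (h j)`: an edge is attached to a vertex at most once, every edge has one of
the sizes `h j`, and every set of `h j` vertices is the vertex set of exactly `lam j` edges. -/
structure IsLambdaK {m : ℕ} (G : HingeHypergraph V E K) (n : ℕ) (lam h : Fin m → ℕ) : Prop where
  card_vertices : Nat.card V = n
  simple : G.IsSimple
  size_eq : ∀ e, ∃ j, G.size e = h j
  multiplicity_eq : ∀ j (U : Finset V), U.card = h j → G.multiplicity U.val = lam j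

/-- The spanning sub-hypergraph with edge set `S`: all vertices, the edges in `S`, and all the
hinges of these edges. -/
def spanningSub (G : HingeHypergraph V E K) (S : Set E) :
    HingeHypergraph V S {x : K // G.edge x ∈ S} where
  vert x := G.vert x.1
  edge x := ⟨G.edge x.1, x.2⟩
  edge_surjective := by
    rintro ⟨e, he⟩
    obtain ⟨x, rfl⟩ := G.edge_surjective e
    exact ⟨⟨x, he⟩, rfl⟩

/-- The spanning sub-hypergraph with edge set `S` is a `(q, r)`-factor: all its degrees lie
between `q` and `r`. -/
def IsFactor (G : HingeHypergraph V E K) (S : Set E) (q r : ℤ) : Prop :=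
  ∀ v, q ≤ ((G.spanningSub S).degree v : ℤ) ∧ ((G.spanningSub S).degree v : ℤ) ≤ r

/-- The edge set is the disjoint union of `F 0, …, F (k - 1)` (some of which may be empty), where
`F i` is a `(Q i, R i)`-factor. -/
def IsFactorization {k : ℕ} (G : HingeHypergraph V E K) (F : Fin k → Set E)
    (Q R : Fin k → ℤ) : Prop :=
  Pairwise (Function.onFun Disjoint F) ∧ (⋃ i, F i) = Set.univ ∧ ∀ i, G.IsFactor (F i) (Q i) (R i)

/-- `G` has a `(Q, R)`-factorization. -/
def IsFactorizable {k : ℕ} (G : HingeHypergraph V E K) (Q R : Fin k → ℤ) : Prop :=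
  ∃ F : Fin k → Set E, G.IsFactorization F Q R

/-- `G` is almost `R`-factorizable: it has a factorization in which the `i`-th factor is an
`(R i - 1, R i)`-factor. -/
def IsAlmostFactorizable {k : ℕ} (G : HingeHypergraph V E K) (R : Fin k → ℕ) : Prop :=
  G.IsFactorizable (fun i => (R i : ℤ) - 1) (fun i => (R i : ℤ))

end HingeHypergraph

/-! Necessity is double counting. Let `A i j` be the number of edges of size `h j` in the factor
`i`. Summing the degree bounds over the factors at one vertex bounds the common degree. Summing them
over the vertices of one factor bounds a row of `A H`, because the degree sum equals the sum of the
edge sizes.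

Sufficiency is Baranyai's method. The matrix `A` says how many edges of each size get each colour;
all edges start out empty, and the vertices are attached to them one at a time. An edge that still
lacks `w` of the `N + 1` untreated vertices should receive the next one with weight `w / (N + 1)`.
This fractional choice gives each colour a degree in `[r - 1, r]` at the new vertex, keeps the
remaining demand of the colour balanced, and makes each trace occur exactly as often as it must in
the final hypergraph. These are integer bounds on the entries and on the row and column sums of a
table, so integrality of transportation polytopes yields an integer choice satisfying them all
(`exists_balanced_split`, iterated in `exists_balanced_traces`). Once every vertex is treated, the
traces are the full vertex sets with the right multiplicities, so the actual edges can be coloured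
accordingly.

The degree condition also follows from the matrix condition: sum the rows and use `h * C(n, h) = n *
C(n - 1, h - 1)`. -/

/-! ### Integrality of transportation polytopes -/

open Finset in
/-- Dimension count: a nonempty set of cells of a finite table that meets every row and every
column in no cell or in at least two cells supports a nonzero real table with vanishing row and
column sums. -/
theorem exists_ne_zero_sum_eq_zero {I J : Type*} [Fintype I] [Fintype J]
    (F : Finset (I × J)) (hF : F.Nonempty)
    (hrow : ∀ p ∈ F, ∃ q ∈ F, q.1 = p.1 ∧ q ≠ p)
    (hcol : ∀ p ∈ F, ∃ q ∈ F, q.2 = p.2 ∧ q ≠ p) :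
    ∃ z : I → J → ℝ, (∃ i j, z i j ≠ 0) ∧ (∀ i j, (i, j) ∉ F → z i j = 0) ∧
      (∀ i, ∑ j, z i j = 0) ∧ ∀ j, ∑ i, z i j = 0 := by
  classical
  obtain ⟨p0, hp0⟩ := hF
  set A : Finset I := F.image Prod.fst with hAdef
  set B : Finset J := F.image Prod.snd with hBdef
  have hA : 2 * #A ≤ #F := by
    refine mul_card_image_le_card (f := Prod.fst) F 2 ?_
    intro a ha
    obtain ⟨p, hp, rfl⟩ := mem_image.1 ha
    obtain ⟨q, hq, h1, h2⟩ := hrow p hp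
    exact one_lt_card.2 ⟨q, by simp [hq, h1], p, by simp [hp], h2⟩
  have hB : 2 * #B ≤ #F := by
    refine mul_card_image_le_card (f := Prod.snd) F 2 ?_
    intro a ha
    obtain ⟨p, hp, rfl⟩ := mem_image.1 ha
    obtain ⟨q, hq, h1, h2⟩ := hcol p hp
    exact one_lt_card.2 ⟨q, by simp [hq, h1], p, by simp [hp], h2⟩
  have hA0 : p0.1 ∈ A := mem_image_of_mem _ hp0
  have hApos : 0 < #A := card_pos.2 ⟨_, hA0⟩
  let ext : (F → ℝ) →ₗ[ℝ] (I → J → ℝ) :=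
    { toFun := fun w i j => if hp : (i, j) ∈ F then w ⟨(i, j), hp⟩ else 0
      map_add' := by
        intro w w'; ext i j; by_cases hp : (i, j) ∈ F <;> simp [hp]
      map_smul' := by
        intro t w; ext i j; by_cases hp : (i, j) ∈ F <;> simp [hp] }
  -- One row equation is dropped, since the total over rows equals the total over columns. This
  -- leaves `#A - 1 + #B` equations, fewer than the `#F` unknowns because `2 * #A ≤ #F` and `2 * #B
  -- ≤ #F`.
  let T : (F → ℝ) →ₗ[ℝ] (A.erase p0.1 → ℝ) × (B → ℝ) :=
    { toFun := fun w => (fun a => ∑ j, ext w a j, fun b => ∑ i, ext w i b)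
      map_add' := by
        intro w w'
        ext a <;> simp [sum_add_distrib]
      map_smul' := by
        intro t w
        ext a <;> simp [mul_sum] }
  have hker : LinearMap.ker T ≠ ⊥ := by
    apply LinearMap.ker_ne_bot_of_finrank_lt
    simp only [Module.finrank_prod, Module.finrank_fintype_fun_eq_card, Fintype.card_coe]
    rw [card_erase_of_mem hA0]
    omega
  obtain ⟨w, hw, hw0⟩ := (Submodule.ne_bot_iff _).1 hker
  have hTw : T w = 0 := hw
  have hext : ∀ i j, (i, j) ∉ F → ext w i j = 0 := fun i j hp => dif_neg hp
  have hc : ∀ j, ∑ i, ext w i j = 0 := by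
    intro j
    by_cases hj : j ∈ B
    · exact congrFun (congrArg Prod.snd hTw) ⟨j, hj⟩
    · exact sum_eq_zero fun i _ => hext i j fun hp => hj (mem_image_of_mem Prod.snd hp)
  have hr' : ∀ i, i ≠ p0.1 → ∑ j, ext w i j = 0 := by
    intro i hi
    by_cases hiA : i ∈ A
    · exact congrFun (congrArg Prod.fst hTw) ⟨i, mem_erase.2 ⟨hi, hiA⟩⟩
    · exact sum_eq_zero fun j _ => hext i j fun hp => hiA (mem_image_of_mem Prod.fst hp)
  refine ⟨ext w, ?_, hext, ?_, hc⟩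
  · obtain ⟨⟨⟨i, j⟩, hp⟩, hne⟩ := Function.ne_iff.1 hw0
    refine ⟨i, j, ?_⟩
    have : ext w i j = w ⟨(i, j), hp⟩ := dif_pos hp
    rw [this]
    exact hne
  · intro i
    by_cases hi : i = p0.1
    · have htot : ∑ i, ∑ j, ext w i j = 0 := by
        rw [sum_comm]
        exact sum_eq_zero fun j _ => hc j
      rw [sum_eq_single p0.1 (fun b _ hb => hr' b hb) (by simp)] at htot
      rw [hi, htot]
    · exact hr' i hi

/-- If all but one of the terms of a sum with integer value are integers, so is the last one. -/
theorem exists_ne_notMem_range_intCast {J : Type*} [Fintype J] (f : J → ℝ) (c : ℤ)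
    (hc : ∑ j, f j = c) (j : J) (hj : f j ∉ Set.range ((↑) : ℤ → ℝ)) :
    ∃ j', f j' ∉ Set.range ((↑) : ℤ → ℝ) ∧ j' ≠ j := by
  classical
  by_contra! hcon
  have : ∀ j', j' ≠ j → ∃ a : ℤ, (a : ℝ) = f j' := fun j' hne => by
    by_contra hn
    exact hne (hcon j' hn)
  choose! g hg using this
  apply hj
  refine ⟨c - ∑ j' ∈ Finset.univ.erase j, g j', ?_⟩
  rw [← Finset.add_sum_erase _ _ (Finset.mem_univ j)] at hc
  push_cast
  rw [← hc, Finset.sum_congr rfl fun x hx => hg x (Finset.ne_of_mem_erase hx)]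
  ring

/-- Integrality of transportation polytopes: if there is a real table between two integer tables
with prescribed integer row and column sums, then there is an integer one. -/
theorem exists_int_table {I J : Type*} [Fintype I] [Fintype J]
    (l u : I → J → ℤ) (a : I → ℤ) (b : J → ℤ) (M : I → J → ℝ)
    (hM : ∀ i j, (l i j : ℝ) ≤ M i j ∧ M i j ≤ u i j)
    (ha : ∀ i, ∑ j, M i j = a i) (hb : ∀ j, ∑ i, M i j = b j) :
    ∃ N : I → J → ℤ, (∀ i j, l i j ≤ N i j ∧ N i j ≤ u i j) ∧
      (∀ i, ∑ j, N i j = a i) ∧ ∀ j, ∑ i, N i j = b j := by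
  classical
  let P : Set (I → J → ℝ) :=
    Set.Icc (fun i j => (l i j : ℝ)) (fun i j => (u i j : ℝ)) ∩
      {X | (∀ i, ∑ j, X i j = a i) ∧ ∀ j, ∑ i, X i j = b j}
  have hclosed : IsClosed {X : I → J → ℝ | (∀ i, ∑ j, X i j = a i) ∧ ∀ j, ∑ i, X i j = b j} := by
    simp only [Set.ofPred_and, Set.ofPred_forall]
    refine IsClosed.inter (isClosed_iInter fun i => ?_) (isClosed_iInter fun j => ?_)
    · exact isClosed_eq (by fun_prop) (by fun_prop)
    · exact isClosed_eq (by fun_prop) (by fun_prop)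
  have hP : IsCompact P := isCompact_Icc.inter_right hclosed
  have hne : P.Nonempty := ⟨M, ⟨fun i j => (hM i j).1, fun i j => (hM i j).2⟩, ha, hb⟩
  -- An extreme point is integral: a line with integer sum cannot contain exactly one non-integer
  -- entry, so the non-integer cells would support a perturbation `z` with zero line sums, and `X`
  -- would be the midpoint of two points of `P`.
  obtain ⟨X, hX⟩ := hP.extremePoints_nonempty hne
  obtain ⟨⟨⟨hXl, hXu⟩, hXa, hXb⟩, hXext⟩ := mem_extremePoints.1 hX
  let F : Finset (I × J) :=
    Finset.univ.filter fun p => X p.1 p.2 ∉ Set.range ((↑) : ℤ → ℝ)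
  have hFmem : ∀ i j, (i, j) ∈ F ↔ X i j ∉ Set.range ((↑) : ℤ → ℝ) := by
    intro i j; simp [F]
  by_cases hF : F.Nonempty
  · exfalso
    obtain ⟨z, ⟨i0, j0, hz0⟩, hzF, hza, hzb⟩ := exists_ne_zero_sum_eq_zero F hF
      (by
        rintro ⟨i, j⟩ hp
        obtain ⟨j', h1, h2⟩ := exists_ne_notMem_range_intCast (X i) (a i) (hXa i) j
          ((hFmem i j).1 hp)
        exact ⟨(i, j'), (hFmem _ _).2 h1, rfl, by simpa using h2⟩)
      (by
        rintro ⟨i, j⟩ hp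
        obtain ⟨i', h1, h2⟩ := exists_ne_notMem_range_intCast (fun i => X i j) (b j) (hXb j) i
          ((hFmem i j).1 hp)
        exact ⟨(i', j), (hFmem _ _).2 h1, rfl, by simpa using h2⟩)
    -- The bounds are integers, so non-integer entries satisfy them strictly; at all other cells `z`
    -- vanishes.
    have hev : ∀ i j, ∀ᶠ t in nhds (0 : ℝ),
        (l i j : ℝ) ≤ X i j + t * z i j ∧ X i j + t * z i j ≤ u i j := by
      intro i j
      by_cases hp : (i, j) ∈ F
      · have hp' := (hFmem i j).1 hp
        have h1 : (l i j : ℝ) < X i j := lt_of_le_of_ne (hXl i j) fun he => hp' ⟨_, he⟩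
        have h2 : X i j < u i j := lt_of_le_of_ne (hXu i j) fun he => hp' ⟨_, he.symm⟩
        have hcont : Filter.Tendsto (fun t : ℝ => X i j + t * z i j) (nhds 0)
            (nhds (X i j)) := by
          have : Continuous fun t : ℝ => X i j + t * z i j := by fun_prop
          simpa using this.tendsto 0
        filter_upwards [hcont.eventually (lt_mem_nhds h1), hcont.eventually (gt_mem_nhds h2)]
          with t ht1 ht2 using ⟨ht1.le, ht2.le⟩
      · refine Filter.Eventually.of_forall fun t => ?_
        rw [hzF i j hp, mul_zero, add_zero]
        exact ⟨hXl i j, hXu i j⟩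
    have hall := Filter.eventually_all.2 fun i => Filter.eventually_all.2 fun j => hev i j
    obtain ⟨ε, hε, hball⟩ := Metric.eventually_nhds_iff.1 hall
    have hmem : ∀ t : ℝ, |t| < ε → (fun i j => X i j + t * z i j) ∈ P := by
      intro t ht
      have hb' := hball (y := t) (by simpa using ht)
      refine ⟨⟨fun i j => (hb' i j).1, fun i j => (hb' i j).2⟩, fun i => ?_, fun j => ?_⟩
      · rw [Finset.sum_add_distrib, ← Finset.mul_sum, hza, hXa, mul_zero, add_zero]
      · rw [Finset.sum_add_distrib, ← Finset.mul_sum, hzb, hXb, mul_zero, add_zero]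
    have h1 := hmem (ε / 2) (by rw [abs_of_pos (by positivity)]; linarith)
    have h2 := hmem (-(ε / 2)) (by rw [abs_neg, abs_of_pos (by positivity)]; linarith)
    have heq := (hXext _ h1 _ h2 ⟨1 / 2, 1 / 2, by norm_num, by norm_num, by norm_num, by
      ext i j
      simp only [Pi.add_apply, Pi.smul_apply, smul_eq_mul]
      ring⟩).1
    have := congrFun (congrFun heq i0) j0
    simp only [add_eq_left, mul_eq_zero, hz0, or_false] at this
    linarith
  · have hint : ∀ i j, ∃ c : ℤ, (c : ℝ) = X i j := by
      intro i j
      by_contra hn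
      exact hF ⟨(i, j), (hFmem i j).2 hn⟩
    choose N hN using hint
    refine ⟨N, fun i j => ⟨?_, ?_⟩, fun i => ?_, fun j => ?_⟩
    · have : (l i j : ℝ) ≤ X i j := hXl i j
      rw [← hN] at this
      exact_mod_cast this
    · have : X i j ≤ (u i j : ℝ) := hXu i j
      rw [← hN] at this
      exact_mod_cast this
    · have := hXa i
      simp only [← hN] at this
      exact_mod_cast this
    · have := hXb j
      simp only [← hN] at this
      exact_mod_cast this

/-- Integrality of transportation polytopes with prescribed column sums and with row sums between
integer bounds. -/
theorem exists_int_table_of_row_bounds {I J : Type*} [Fintype I] [Fintype J]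
    (l u : I → J → ℤ) (a a' : I → ℤ) (b : J → ℤ) (M : I → J → ℝ)
    (hM : ∀ i j, (l i j : ℝ) ≤ M i j ∧ M i j ≤ u i j)
    (ha : ∀ i, (a i : ℝ) ≤ ∑ j, M i j ∧ ∑ j, M i j ≤ a' i) (hb : ∀ j, ∑ i, M i j = b j) :
    ∃ N : I → J → ℤ, (∀ i j, l i j ≤ N i j ∧ N i j ≤ u i j) ∧
      (∀ i, a i ≤ ∑ j, N i j ∧ ∑ j, N i j ≤ a' i) ∧ ∀ j, ∑ i, N i j = b j := by
  -- The extra column `none` holds the slack of each row below its upper bound `a' i`, so every row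
  -- sum becomes exactly `a' i`.
  obtain ⟨N, hN, hNa, hNb⟩ := exists_int_table (J := Option J)
    (fun i o => o.elim 0 (l i)) (fun i o => o.elim (a' i - a i) (u i)) a'
    (fun o => o.elim (∑ i, a' i - ∑ j, b j) b)
    (fun i o => o.elim (a' i - ∑ j, M i j) (M i))
    (by
      rintro i (_ | j)
      · have := ha i
        simp only [Option.elim]
        push_cast
        constructor <;> linarith
      · exact hM i j)
    (by intro i; simp [Fintype.sum_option])
    (by
      rintro (_ | j)
      · simp only [Option.elim]
        push_cast
        rw [Finset.sum_sub_distrib, Finset.sum_comm (f := M), Finset.sum_congr rfl fun j _ => hb j]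
      · exact hb j)
  refine ⟨fun i j => N i (some j), fun i j => hN i (some j), fun i => ?_, fun j => hNb (some j)⟩
  have h1 := hNa i
  have h2 := hN i none
  simp only [Fintype.sum_option] at h1
  simp only [Option.elim] at h2
  constructor <;> linarith

/-! ### Baranyai's induction on the vertices -/

/-- One step of the construction of a factorization: a table `x`, whose columns have weights `w`,
is split into the part `y` of the objects that get attached to a new vertex and the rest, so that
all row sums of `y` are balanced, and so that the remaining weights in the rows stay balanced. -/
theorem exists_balanced_split {I J : Type*} [Fintype I] [Fintype J] (N : ℕ) (r : I → ℤ)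
    (x : I → J → ℤ) (w c : J → ℤ) (hx : ∀ i j, 0 ≤ x i j)
    (hw : ∀ i j, x i j ≠ 0 → 0 ≤ w j ∧ w j ≤ N + 1)
    (hc : ∀ j, (N + 1) * c j = w j * ∑ i, x i j)
    (hr : ∀ i, (r i - 1) * (N + 1) ≤ ∑ j, x i j * w j ∧ ∑ j, x i j * w j ≤ r i * (N + 1)) :
    ∃ y : I → J → ℤ, (∀ i j, 0 ≤ y i j ∧ y i j ≤ x i j) ∧
      (∀ i, r i - 1 ≤ ∑ j, y i j ∧ ∑ j, y i j ≤ r i) ∧ (∀ j, ∑ i, y i j = c j) ∧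
      ∀ i, (r i - 1) * N ≤ ∑ j, x i j * w j - ∑ j, y i j ∧
        ∑ j, x i j * w j - ∑ j, y i j ≤ r i * N := by
  set D : I → ℤ := fun i => ∑ j, x i j * w j with hD
  have hN : (0 : ℝ) < N + 1 := by positivity
  -- The fractional solution takes the share `w j / (N + 1)` of each cell, giving row sum `D i / (N
  -- + 1)` and remainder `D i * N / (N + 1)`. The maximum and minimum combine the bounds on the row
  -- sum with those on the remainder.
  obtain ⟨y, hy, hya, hyb⟩ := exists_int_table_of_row_bounds (fun _ _ => 0) x
    (fun i => max (r i - 1) (D i - r i * N)) (fun i => min (r i) (D i - (r i - 1) * N)) c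
    (fun i j => (x i j : ℝ) * w j / (N + 1))
    (by
      intro i j
      by_cases h0 : x i j = 0
      · simp [h0]
      · obtain ⟨h1, h2⟩ := hw i j h0
        have hx' : (0 : ℝ) ≤ x i j := by exact_mod_cast hx i j
        have h1' : (0 : ℝ) ≤ w j := by exact_mod_cast h1
        have h2' : (w j : ℝ) ≤ N + 1 := by exact_mod_cast h2
        refine ⟨?_, ?_⟩
        · push_cast
          positivity
        · rw [div_le_iff₀ hN]
          exact mul_le_mul_of_nonneg_left h2' hx')
    (by
      intro i
      have hsum : ∑ j, (x i j : ℝ) * w j / (N + 1) = (D i : ℝ) / (N + 1) := by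
        rw [← Finset.sum_div]
        simp [hD]
      obtain ⟨h1, h2⟩ := hr i
      have h1' : ((r i : ℝ) - 1) * (N + 1) ≤ D i := by exact_mod_cast h1
      have h2' : (D i : ℝ) ≤ r i * (N + 1) := by exact_mod_cast h2
      have hN0 : (0 : ℝ) ≤ N := by positivity
      rw [hsum]
      push_cast
      rw [max_le_iff, le_min_iff, le_div_iff₀ hN, le_div_iff₀ hN, div_le_iff₀ hN, div_le_iff₀ hN]
      refine ⟨⟨h1', ?_⟩, h2', ?_⟩ <;> nlinarith)
    (by
      intro j
      rw [← Finset.sum_div, div_eq_iff hN.ne', ← Finset.sum_mul]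
      have := hc j
      have h' : ((N : ℝ) + 1) * c j = w j * ∑ i, (x i j : ℝ) := by exact_mod_cast this
      linarith)
  refine ⟨y, hy, fun i => ?_, hyb, fun i => ?_⟩
  · exact ⟨(le_max_left _ _).trans (hya i).1, (hya i).2.trans (min_le_left _ _)⟩
  · have h1 := (le_max_right _ _).trans (hya i).1
    have h2 := (hya i).2.trans (min_le_right _ _)
    constructor <;> linarith

/-- The number of ways to extend a set of `u` elements to one of `h` elements by some of `N` further
elements. -/
def extensionCount (N h u : ℕ) : ℕ := if u ≤ h then N.choose (h - u) else 0

/-- Pascal's rule: a further element is either left out or put in. At `u = h` the zero branch of the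
definition matters, as truncated subtraction would give `N.choose 0 = 1`. -/
theorem extensionCount_succ (N h u : ℕ) :
    extensionCount (N + 1) h u = extensionCount N h u + extensionCount N h (u + 1) := by
  unfold extensionCount
  rcases lt_trichotomy u h with hu | rfl | hu
  · obtain ⟨d, rfl⟩ := Nat.exists_eq_add_of_lt hu
    rw [if_pos (by omega), if_pos (by omega), if_pos (by omega),
      show u + d + 1 - u = d + 1 by omega, show u + d + 1 - (u + 1) = d by omega,
      Nat.choose_succ_succ, add_comm]
  · simp
  · rw [if_neg (by omega), if_neg (by omega), if_neg (by omega)]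

/-- The absorption identity for binomial coefficients. It says that the fractional choice has the
integer column sums required for the enlarged traces. -/
theorem succ_mul_extensionCount (N h u : ℕ) :
    ((N : ℤ) + 1) * extensionCount N h (u + 1) = ((h : ℤ) - u) * extensionCount (N + 1) h u := by
  unfold extensionCount
  rcases lt_trichotomy u h with hu | rfl | hu
  · obtain ⟨d, rfl⟩ := Nat.exists_eq_add_of_lt hu
    rw [if_pos (by omega), if_pos (by omega),
      show u + d + 1 - u = d + 1 by omega, show u + d + 1 - (u + 1) = d by omega]
    have := Nat.add_one_mul_choose_eq N d
    have h' : ((N : ℤ) + 1) * N.choose d = (N + 1).choose (d + 1) * (d + 1) := by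
      exact_mod_cast this
    rw [h']
    push_cast
    ring
  · simp
  · rw [if_neg (by omega), if_neg (by omega)]
    simp

theorem le_and_le_of_extensionCount_ne_zero {N h u : ℕ} (hne : extensionCount N h u ≠ 0) :
    u ≤ h ∧ h ≤ u + N := by
  unfold extensionCount at hne
  split_ifs at hne with hu
  · refine ⟨hu, ?_⟩
    by_contra hcon
    exact hne (Nat.choose_eq_zero_of_lt (by omega))
  · exact absurd rfl hne

/-- Baranyai's induction. After the vertices in `S` have been treated, `x i j U` edges of eventual
size `h j` and of colour `i` have trace `U` on `S`. -/
theorem exists_balanced_traces {I κ V : Type*} [Fintype I] [Fintype κ] [Fintype V] [DecidableEq V]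
    (lam h : κ → ℕ) (r : I → ℤ) (A : I → κ → ℕ)
    (hA : ∀ i, (r i - 1) * Fintype.card V ≤ ∑ j, (A i j : ℤ) * h j ∧
      ∑ j, (A i j : ℤ) * h j ≤ r i * Fintype.card V)
    (hcol : ∀ j, ∑ i, A i j = lam j * (Fintype.card V).choose (h j)) (S : Finset V) :
    ∃ x : I → κ → Finset V → ℤ, (∀ i j U, 0 ≤ x i j U) ∧
      (∀ j U, U ⊆ S →
        ∑ i, x i j U = lam j * extensionCount (Fintype.card V - S.card) (h j) U.card) ∧
      (∀ i, ∀ v ∈ S, r i - 1 ≤ ∑ j, ∑ U ∈ S.powerset, (if v ∈ U then x i j U else 0) ∧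
        ∑ j, ∑ U ∈ S.powerset, (if v ∈ U then x i j U else 0) ≤ r i) ∧
      ∀ i, (r i - 1) * (Fintype.card V - S.card : ℕ) ≤
          ∑ j, ∑ U ∈ S.powerset, x i j U * ((h j : ℤ) - U.card) ∧
        ∑ j, ∑ U ∈ S.powerset, x i j U * ((h j : ℤ) - U.card) ≤
          r i * (Fintype.card V - S.card : ℕ) := by
  induction S using Finset.induction_on with
  | empty =>
    refine ⟨fun i j _ => A i j, fun i j U => by positivity, ?_, by simp, ?_⟩
    · intro j U hU
      rw [Finset.subset_empty.1 hU]
      simp only [Finset.card_empty, Nat.sub_zero, extensionCount, Nat.zero_le, if_true]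
      exact_mod_cast hcol j
    · simpa using hA
  | insert v S hv ih =>
    obtain ⟨x, hx0, hxcol, hxdeg, hxrem⟩ := ih
    obtain ⟨N, hN⟩ : ∃ N, Fintype.card V = S.card + 1 + N := by
      have : (insert v S).card ≤ Fintype.card V := Finset.card_le_univ _
      rw [Finset.card_insert_of_notMem hv] at this
      exact Nat.exists_eq_add_of_le this
    have hN1 : Fintype.card V - S.card = N + 1 := by omega
    have hN2 : Fintype.card V - (insert v S).card = N := by
      rw [Finset.card_insert_of_notMem hv]; omega
    rw [hN1] at hxcol hxrem
    rw [hN2]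
    have hsum : ∀ f : κ → Finset V → ℤ,
        ∑ p : κ × S.powerset, f p.1 p.2 = ∑ j, ∑ U ∈ S.powerset, f j U := by
      intro f
      rw [Fintype.sum_prod_type]
      exact Finset.sum_congr rfl fun j _ => Finset.sum_coe_sort S.powerset (f j)
    have hle : ∀ i j U, x i j U ≤ ∑ i, x i j U := fun i j U =>
      Finset.single_le_sum (f := fun i => x i j U) (fun i _ => hx0 i j U) (Finset.mem_univ i)
    -- An edge in column `(j, U)` still lacks `h j - #U` vertices. The prescribed column sum is the
    -- number of edges whose trace must grow from `U` to `insert v U`.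
    obtain ⟨y, hy, hyrow, hycol, hyrem⟩ := exists_balanced_split (J := κ × S.powerset) N r
      (fun i p => x i p.1 p.2) (fun p => (h p.1 : ℤ) - (p.2 : Finset V).card)
      (fun p => lam p.1 * extensionCount N (h p.1) ((p.2 : Finset V).card + 1))
      (fun i p => hx0 i p.1 p.2)
      (by
        rintro i ⟨j, U, hU⟩ hne
        have h1 := hle i j U
        rw [hxcol j U (Finset.mem_powerset.1 hU)] at h1
        have h2 : extensionCount (N + 1) (h j) U.card ≠ 0 := by
          intro h0
          rw [h0] at h1
          have := hx0 i j U
          simp only at hne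
          simp only [Nat.cast_zero, mul_zero] at h1
          omega
        have h3 := le_and_le_of_extensionCount_ne_zero h2
        simp only
        omega)
      (by
        rintro ⟨j, U, hU⟩
        simp only
        rw [hxcol j U (Finset.mem_powerset.1 hU)]
        have := succ_mul_extensionCount N (h j) U.card
        linear_combination (lam j : ℤ) * this)
      (by
        intro i
        rw [hsum fun j U => x i j U * ((h j : ℤ) - U.card)]
        exact_mod_cast hxrem i)
    let Y : I → κ → Finset V → ℤ := fun i j U =>
      if hU : U ∈ S.powerset then y i (j, ⟨U, hU⟩) else 0
    have hYy : ∀ i (p : κ × S.powerset), y i p = Y i p.1 p.2 := by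
      rintro i ⟨j, U, hU⟩
      simp only [Y, dif_pos hU]
    have hY : ∀ i j U, 0 ≤ Y i j U ∧ Y i j U ≤ x i j U := by
      intro i j U
      by_cases hU : U ∈ S.powerset
      · rw [← hYy i (j, ⟨U, hU⟩)]
        exact hy i (j, ⟨U, hU⟩)
      · simp only [Y, dif_neg hU]
        exact ⟨le_rfl, hx0 i j U⟩
    have hYcol : ∀ j U, U ⊆ S → ∑ i, Y i j U = lam j * extensionCount N (h j) (U.card + 1) := by
      intro j U hU
      rw [← hycol (j, ⟨U, Finset.mem_powerset.2 hU⟩)]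
      exact Finset.sum_congr rfl fun i _ => (hYy i (j, ⟨U, Finset.mem_powerset.2 hU⟩)).symm
    have hYsum : ∀ i, ∑ p, y i p = ∑ j, ∑ U ∈ S.powerset, Y i j U := by
      intro i
      rw [← hsum (Y i)]
      exact Finset.sum_congr rfl fun p _ => hYy i p
    have hxsum := fun i => hsum fun j U => x i j U * ((h j : ℤ) - U.card)
    simp only [hYsum, hxsum] at hyrow hyrem
    have hnot : ∀ U ∈ S.powerset, v ∉ U := fun U hU hvU => hv (Finset.mem_powerset.1 hU hvU)
    -- The chosen edges `Y` move from trace `U` to `insert v U`; the others keep their trace.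
    refine ⟨fun i j U => if v ∈ U then Y i j (U.erase v) else x i j U - Y i j U, ?_, ?_, ?_, ?_⟩
    · intro i j U
      simp only
      split_ifs
      · exact (hY i j _).1
      · exact sub_nonneg.2 (hY i j U).2
    · intro j U hU
      by_cases hvU : v ∈ U
      · simp only [hvU, if_true]
        rw [hYcol j (U.erase v) (Finset.subset_insert_iff.1 hU), Finset.card_erase_add_one hvU]
      · simp only [hvU, if_false]
        have hUS := (Finset.subset_insert_iff_of_notMem hvU).1 hU
        rw [Finset.sum_sub_distrib, hxcol j U hUS, hYcol j U hUS, extensionCount_succ]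
        push_cast
        ring
    · intro i t ht
      -- Degrees at old vertices do not change, since the chosen and unchosen parts add up to `x`
      -- again; the degree at `v` is the row sum of `Y`.
      have key : ∀ j, ∑ U ∈ (insert v S).powerset,
          (if t ∈ U then (if v ∈ U then Y i j (U.erase v) else x i j U - Y i j U) else 0) =
          ∑ U ∈ S.powerset, if t = v then Y i j U else if t ∈ U then x i j U else 0 := by
        intro j
        rw [Finset.sum_powerset_insert hv, ← Finset.sum_add_distrib]
        refine Finset.sum_congr rfl fun U hU => ?_
        have hvU := hnot U hU
        rw [Finset.erase_insert hvU]
        by_cases htv : t = v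
        · subst htv
          simp [hvU]
        · simp only [hvU, htv, Finset.mem_insert, true_or, if_true, if_false, false_or]
          split_ifs <;> ring
      simp only [key]
      by_cases htv : t = v
      · simp only [htv, if_true]
        exact hyrow i
      · simp only [htv, if_false]
        exact hxdeg i t (Finset.mem_of_mem_insert_of_ne ht htv)
    · intro i
      -- Each chosen edge lacks one vertex fewer, so the demand drops by the row sum of `Y`.
      have key : ∑ j, ∑ U ∈ (insert v S).powerset,
          (if v ∈ U then Y i j (U.erase v) else x i j U - Y i j U) * ((h j : ℤ) - U.card) =
          ∑ j, ∑ U ∈ S.powerset, x i j U * ((h j : ℤ) - U.card) -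
            ∑ j, ∑ U ∈ S.powerset, Y i j U := by
        rw [← Finset.sum_sub_distrib]
        refine Finset.sum_congr rfl fun j _ => ?_
        rw [Finset.sum_powerset_insert hv, ← Finset.sum_add_distrib, ← Finset.sum_sub_distrib]
        refine Finset.sum_congr rfl fun U hU => ?_
        have hvU := hnot U hU
        rw [Finset.erase_insert hvU, Finset.card_insert_of_notMem hvU]
        simp only [hvU, Finset.mem_insert, true_or, if_true, if_false]
        push_cast
        ring
      simp only [key]
      exact hyrem i

/-! ### Colouring a family of sets: sufficiency -/

open Finset in
/-- The fibres of a map can be coloured with prescribed numbers of elements of each colour. -/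
theorem exists_coloring_of_card_fiber {E W I : Type*} [Fintype E] [Fintype I] [DecidableEq W]
    [DecidableEq I] (φ : E → W) (w : I → W → ℕ) (hw : ∀ U, #{e | φ e = U} = ∑ i, w i U) :
    ∃ c : E → I, ∀ i U, #{e | φ e = U ∧ c e = i} = w i U := by
  have hequiv : ∀ U, Nonempty ({e // φ e = U} ≃ Σ i, Fin (w i U)) := by
    intro U
    refine Fintype.card_eq.1 ?_
    rw [Fintype.card_subtype, hw, Fintype.card_sigma]
    simp
  let f := fun U => (hequiv U).some
  refine ⟨fun e => (f (φ e) ⟨e, rfl⟩).1, fun i U => ?_⟩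
  have hc : ∀ e (he : φ e = U), (f (φ e) ⟨e, rfl⟩).1 = (f U ⟨e, he⟩).1 := by
    rintro e rfl
    rfl
  rw [← Fintype.card_fin (w i U), ← Finset.card_univ]
  symm
  refine Finset.card_bij (fun t _ => ((f U).symm ⟨i, t⟩).1) ?_ ?_ ?_
  · intro t _
    have h1 := ((f U).symm ⟨i, t⟩).2
    refine mem_filter.2 ⟨mem_univ _, h1, ?_⟩
    refine (hc _ h1).trans ?_
    simp
  · intro t _ t' _ htt
    have := (f U).symm.injective (Subtype.ext htt)
    simpa using this
  · intro e he
    obtain ⟨-, he1, he2⟩ := mem_filter.1 he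
    replace he2 := (hc e he1).symm.trans he2
    obtain ⟨⟨i', t⟩, hs⟩ : ∃ s, f U ⟨e, he1⟩ = s := ⟨_, rfl⟩
    rw [hs] at he2
    obtain rfl : i' = i := he2
    refine ⟨t, mem_univ _, ?_⟩
    rw [← hs]
    simp

section

variable {E V I κ : Type*} [Fintype E] [Fintype V] [Fintype I] [Fintype κ] [DecidableEq V]
  [DecidableEq I]

open Finset in
/-- A family of sets in which every set of size `h j` occurs `lam j` times has a colouring with
almost regular colour classes of prescribed numbers of sets of each size. -/
theorem exists_almost_regular_coloring (φ : E → Finset V) (lam h : κ → ℕ)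
    (hinj : Function.Injective h) (hsize : ∀ e, ∃ j, #(φ e) = h j)
    (hmult : ∀ j (U : Finset V), #U = h j → #{e | φ e = U} = lam j) (r : I → ℤ)
    (A : I → κ → ℕ)
    (hA : ∀ i, (r i - 1) * Fintype.card V ≤ ∑ j, (A i j : ℤ) * h j ∧
      ∑ j, (A i j : ℤ) * h j ≤ r i * Fintype.card V)
    (hcol : ∀ j, ∑ i, A i j = lam j * (Fintype.card V).choose (h j)) :
    ∃ c : E → I, ∀ i v, r i - 1 ≤ (#{e | c e = i ∧ v ∈ φ e} : ℤ) ∧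
      (#{e | c e = i ∧ v ∈ φ e} : ℤ) ≤ r i := by
  obtain ⟨x, hx0, hxcol, hxdeg, -⟩ := exists_balanced_traces lam h r A hA hcol univ
  have hxw : ∀ i U, (((∑ j, x i j U).toNat : ℕ) : ℤ) = ∑ j, x i j U := fun i U =>
    Int.toNat_of_nonneg (sum_nonneg fun j _ => hx0 i j U)
  -- With no vertex left to add, only sets of the full size `h j` survive as traces.
  have hext : ∀ j (U : Finset V), ∑ i, x i j U = if #U = h j then (lam j : ℤ) else 0 := by
    intro j U
    rw [hxcol j U (subset_univ U), card_univ, Nat.sub_self]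
    unfold extensionCount
    rcases lt_trichotomy #U (h j) with hlt | heq | hgt
    · rw [if_pos hlt.le, if_neg hlt.ne, Nat.choose_eq_zero_of_lt (by omega)]
      simp
    · simp [heq]
    · rw [if_neg (by omega), if_neg hgt.ne']
      simp
  -- As `h` is injective, at most one `j` contributes to the number of edges on `U`.
  obtain ⟨c, hc⟩ := exists_coloring_of_card_fiber φ (fun i U => (∑ j, x i j U).toNat) (by
    intro U
    zify
    simp only [hxw]
    rw [sum_comm]
    simp only [hext]
    by_cases hU : ∃ j, #U = h j
    · obtain ⟨j, hj⟩ := hU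
      rw [sum_eq_single j (fun j' _ hne => if_neg fun he => hne (hinj (he.symm.trans hj)))
        (by simp), if_pos hj, hmult j U hj]
    · rw [sum_eq_zero fun j _ => if_neg fun he => hU ⟨j, he⟩, filter_eq_empty_iff.2]
      · simp
      · rintro e - rfl
        exact hU (hsize e))
  refine ⟨c, fun i v => ?_⟩
  have key : (#{e | c e = i ∧ v ∈ φ e} : ℤ) =
      ∑ j, ∑ U ∈ (univ : Finset V).powerset, if v ∈ U then x i j U else 0 := by
    rw [card_eq_sum_card_fiberwise (f := φ) (t := univ) (fun _ _ => mem_coe.2 (mem_univ _)),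
      sum_comm, powerset_univ]
    push_cast
    refine sum_congr rfl fun U _ => ?_
    by_cases hvU : v ∈ U
    · simp only [hvU, if_true]
      rw [← hxw, ← hc i U]
      congr 2
      ext e
      simp only [mem_filter, mem_univ, true_and]
      constructor
      · rintro ⟨⟨h1, -⟩, h2⟩
        exact ⟨h2, h1⟩
      · rintro ⟨rfl, h1⟩
        exact ⟨⟨h1, hvU⟩, rfl⟩
    · simp only [hvU, if_false, sum_const_zero, Nat.cast_eq_zero, card_eq_zero]
      refine filter_eq_empty_iff.2 ?_
      rintro e he rfl
      exact hvU (mem_filter.1 he).2.2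
  rw [key]
  exact hxdeg i v (mem_univ v)

/-! ### Double counting: necessity -/

open Finset in
theorem card_filter_card_eq (φ : E → Finset V) {l d : ℕ}
    (hmult : ∀ U : Finset V, #U = d → #{e | φ e = U} = l) :
    #{e | #(φ e) = d} = l * (Fintype.card V).choose d := by
  rw [card_eq_sum_card_fiberwise (f := φ) (t := powersetCard d univ)
    (fun e he => by simpa using he), sum_congr rfl (g := fun _ => l)]
  · rw [sum_const, card_powersetCard, card_univ, smul_eq_mul, mul_comm]
  · intro U hU
    have hU' := (mem_powersetCard.1 hU).2
    rw [← hmult U hU', filter_filter]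
    congr 1
    ext e
    simp only [mem_filter, mem_univ, true_and, and_iff_right_iff_imp]
    rintro rfl
    exact hU'

open Finset in
theorem card_powersetCard_filter_mem (v : V) {d : ℕ} (hd : 1 ≤ d) :
    #{U ∈ powersetCard d (univ : Finset V) | v ∈ U} = (Fintype.card V - 1).choose (d - 1) := by
  rw [← card_univ, ← card_erase_of_mem (mem_univ v), ← card_powersetCard]
  refine card_nbij' (fun U => U.erase v) (fun U => insert v U) ?_ ?_ ?_ ?_
  · intro U hU
    simp only [coe_filter, mem_powersetCard, Set.mem_ofPred_eq] at hU
    simp only [mem_coe, mem_powersetCard]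
    exact ⟨erase_subset_erase v hU.1.1, by rw [card_erase_of_mem hU.2, hU.1.2]⟩
  · intro U hU
    simp only [mem_coe, mem_powersetCard] at hU
    have hvU : v ∉ U := fun hv => notMem_erase v univ (hU.1 hv)
    simp only [coe_filter, mem_powersetCard, Set.mem_ofPred_eq]
    refine ⟨⟨subset_univ _, ?_⟩, mem_insert_self v U⟩
    rw [card_insert_of_notMem hvU, hU.2]
    omega
  · intro U hU
    exact insert_erase (mem_filter.1 (mem_coe.1 hU)).2
  · intro U hU
    simp only [mem_coe, mem_powersetCard] at hU
    exact erase_insert fun hv => notMem_erase v univ (hU.1 hv)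

open Finset in
theorem card_filter_card_eq_and_mem (φ : E → Finset V) {l d : ℕ} (hd : 1 ≤ d)
    (hmult : ∀ U : Finset V, #U = d → #{e | φ e = U} = l) (v : V) :
    #{e | #(φ e) = d ∧ v ∈ φ e} = l * (Fintype.card V - 1).choose (d - 1) := by
  rw [card_eq_sum_card_fiberwise (f := φ) (t := {U ∈ powersetCard d (univ : Finset V) | v ∈ U})
    (fun e he => by simpa using he), sum_congr rfl (g := fun _ => l)]
  · rw [sum_const, card_powersetCard_filter_mem v hd, smul_eq_mul, mul_comm]
  · intro U hU
    obtain ⟨hU1, hU2⟩ := mem_filter.1 hU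
    have hU' := (mem_powersetCard.1 hU1).2
    rw [← hmult U hU', filter_filter]
    congr 1
    ext e
    simp only [mem_filter, mem_univ, true_and, and_iff_right_iff_imp]
    rintro rfl
    exact ⟨hU', hU2⟩

open Finset in
theorem card_filter_mem_eq_sum (φ : E → Finset V) (lam h : κ → ℕ) (hinj : Function.Injective h)
    (hh : ∀ j, 1 ≤ h j) (hsize : ∀ e, ∃ j, #(φ e) = h j)
    (hmult : ∀ j (U : Finset V), #U = h j → #{e | φ e = U} = lam j) (v : V) :
    #{e | v ∈ φ e} = ∑ j, lam j * (Fintype.card V - 1).choose (h j - 1) := by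
  classical
  choose s hs using hsize
  rw [card_eq_sum_card_fiberwise (f := s) (t := univ) (fun _ _ => mem_coe.2 (mem_univ _))]
  refine sum_congr rfl fun j _ => ?_
  rw [← card_filter_card_eq_and_mem φ (hh j) (hmult j) v, filter_filter]
  congr 1
  ext e
  simp only [mem_filter, mem_univ, true_and]
  rw [and_comm, hs e, hinj.eq_iff]

open Finset in
/-- The necessity of the numerical conditions for a colouring with almost regular classes. -/
theorem numerical_conditions_of_coloring [Nonempty V] (φ : E → Finset V) (lam h : κ → ℕ)
    (hinj : Function.Injective h)
    (hh : ∀ j, 1 ≤ h j) (hsize : ∀ e, ∃ j, #(φ e) = h j)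
    (hmult : ∀ j (U : Finset V), #U = h j → #{e | φ e = U} = lam j) (r : I → ℤ)
    (c : E → I) (hc : ∀ i v, r i - 1 ≤ (#{e | c e = i ∧ v ∈ φ e} : ℤ) ∧
      (#{e | c e = i ∧ v ∈ φ e} : ℤ) ≤ r i) :
    (∑ i, r i - Fintype.card I ≤
        ((∑ j, lam j * (Fintype.card V - 1).choose (h j - 1) : ℕ) : ℤ) ∧
      ((∑ j, lam j * (Fintype.card V - 1).choose (h j - 1) : ℕ) : ℤ) ≤ ∑ i, r i) ∧
    ∃ A : I → κ → ℕ,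
      (∀ i, (r i - 1) * Fintype.card V ≤ ∑ j, (A i j : ℤ) * h j ∧
        ∑ j, (A i j : ℤ) * h j ≤ r i * Fintype.card V) ∧
      ∀ j, ∑ i, A i j = lam j * (Fintype.card V).choose (h j) := by
  classical
  refine ⟨?_, fun i j => #{e | c e = i ∧ #(φ e) = h j}, fun i => ?_, fun j => ?_⟩
  · obtain ⟨v⟩ := ‹Nonempty V›
    rw [← card_filter_mem_eq_sum φ lam h hinj hh hsize hmult v,
      card_eq_sum_card_fiberwise (f := c) (t := univ) (fun _ _ => mem_coe.2 (mem_univ _))]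
    simp only [filter_filter, and_comm (a := v ∈ φ _)]
    push_cast
    constructor
    · have := sum_le_sum fun i (_ : i ∈ univ) => (hc i v).1
      simpa [sum_sub_distrib] using this
    · exact sum_le_sum fun i _ => (hc i v).2
  -- Both sides count the incident pairs of a vertex and an edge of colour `i`.
  · have key : ∑ j, (#{e | c e = i ∧ #(φ e) = h j} : ℤ) * h j =
        ∑ v, (#{e | c e = i ∧ v ∈ φ e} : ℤ) := by
      have h1 : ∑ v, #{e | c e = i ∧ v ∈ φ e} = ∑ e with c e = i, #(φ e) := by
        simp only [← filter_filter]
        have := sum_card_bipartiteAbove_eq_sum_card_bipartiteBelow (s := {e | c e = i})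
          (t := univ) fun e v => v ∈ φ e
        simpa [bipartiteAbove, bipartiteBelow] using this.symm
      have h2 : ∑ j, #{e | c e = i ∧ #(φ e) = h j} * h j = ∑ e with c e = i, #(φ e) := by
        choose s hs using hsize
        rw [← sum_fiberwise (s := {e | c e = i}) (g := s)]
        refine sum_congr rfl fun j _ => ?_
        rw [filter_filter, sum_congr rfl (g := fun _ => h j), sum_const, smul_eq_mul]
        · congr 2
          ext e
          simp only [mem_filter, mem_univ, true_and, hs, hinj.eq_iff]
        · intro e he
          rw [hs, (mem_filter.1 he).2.2]
      exact_mod_cast h2.trans h1.symm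
    rw [key]
    constructor
    · have := sum_le_sum fun v (_ : v ∈ (univ : Finset V)) => (hc i v).1
      rw [sum_const, card_univ, nsmul_eq_mul] at this
      linarith
    · have := sum_le_sum fun v (_ : v ∈ (univ : Finset V)) => (hc i v).2
      rw [sum_const, card_univ, nsmul_eq_mul] at this
      linarith
  · rw [← card_filter_card_eq φ (hmult j),
      card_eq_sum_card_fiberwise (f := c) (t := univ) (fun _ _ => mem_coe.2 (mem_univ _))]
    simp only [filter_filter, and_comm]

end

/-! ### From hinges to families of vertex sets -/

namespace HingeHypergraph

variable {V E K : Type*} [Fintype V]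

open Classical in
/-- The set of vertices incident with an edge. -/
noncomputable def verts (G : HingeHypergraph V E K) (e : E) : Finset V :=
  Finset.univ.filter fun v => ∃ x : K, G.vert x = v ∧ G.edge x = e

theorem mem_verts (G : HingeHypergraph V E K) {e : E} {v : V} :
    v ∈ G.verts e ↔ ∃ x : K, G.vert x = v ∧ G.edge x = e := by
  simp [verts]

theorem size_eq_card_verts (G : HingeHypergraph V E K) (e : E) : G.size e = (G.verts e).card := by
  classical
  unfold size verts
  rw [Nat.card_eq_fintype_card, Fintype.card_subtype]

-- Finiteness of `K` matters: `Nat.card` of an infinite type is `0`, so the bound in `IsSimple`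
-- would not exclude infinitely many hinges.
open Classical in
theorem IsSimple.hingeCount_eq [Finite K] {G : HingeHypergraph V E K} (hG : G.IsSimple) (v : V) (e : E) :
    G.hingeCount v e = if v ∈ G.verts e then 1 else 0 := by
  by_cases hv : v ∈ G.verts e
  · rw [if_pos hv]
    obtain ⟨x, hx⟩ := G.mem_verts.1 hv
    have : Nonempty {x : K // G.vert x = v ∧ G.edge x = e} := ⟨⟨x, hx⟩⟩
    exact le_antisymm (hG v e) Nat.card_pos
  · rw [if_neg hv]
    have : IsEmpty {x : K // G.vert x = v ∧ G.edge x = e} :=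
      ⟨fun x => hv (G.mem_verts.2 ⟨x.1, x.2⟩)⟩
    exact Nat.card_of_isEmpty

open Classical in
theorem IsSimple.multiplicity_eq [Fintype E] [Finite K] {G : HingeHypergraph V E K} (hG : G.IsSimple) (U : Finset V) :
    G.multiplicity U.val = (Finset.univ.filter fun e => G.verts e = U).card := by
  unfold multiplicity
  rw [Nat.card_eq_fintype_card, Fintype.card_subtype]
  congr 1
  ext e
  simp only [Finset.mem_filter, Finset.mem_univ, true_and, hG.hingeCount_eq, Finset.ext_iff]
  refine forall_congr' fun v => ?_
  rw [Multiset.count_eq_of_nodup U.nodup]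
  by_cases h1 : v ∈ G.verts e <;> by_cases h2 : v ∈ U <;> simp [h1, h2]

-- In a simple hypergraph a hinge at `v` is determined by its edge, so hinges at `v` correspond to
-- edges containing `v`.
open Classical in
theorem IsSimple.degree_spanningSub [Fintype E] [Finite K] {G : HingeHypergraph V E K} (hG : G.IsSimple) (S : Set E)
    (v : V) : (G.spanningSub S).degree v =
      (Finset.univ.filter fun e => e ∈ S ∧ v ∈ G.verts e).card := by
  unfold degree
  rw [← Fintype.card_subtype, ← Nat.card_eq_fintype_card]
  refine Nat.card_congr (Equiv.ofBijective
    (fun x => ⟨G.edge x.1.1, x.1.2, G.mem_verts.2 ⟨x.1.1, x.2, rfl⟩⟩) ⟨?_, ?_⟩)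
  · rintro ⟨⟨x, hxS⟩, hx⟩ ⟨⟨y, hyS⟩, hy⟩ hxy
    have hxy' : G.edge x = G.edge y := congrArg Subtype.val hxy
    have : Subsingleton {z : K // G.vert z = v ∧ G.edge z = G.edge y} :=
      Finite.card_le_one_iff_subsingleton.1 (hG v (G.edge y))
    have h := Subsingleton.elim (⟨x, hx, hxy'⟩ : {z : K // G.vert z = v ∧ G.edge z = G.edge y})
      ⟨y, hy, rfl⟩
    obtain rfl : x = y := congrArg Subtype.val h
    rfl
  · rintro ⟨e, heS, hev⟩
    obtain ⟨x, hx, rfl⟩ := G.mem_verts.1 hev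
    exact ⟨⟨⟨x, heS⟩, hx⟩, rfl⟩

open Classical in
theorem IsSimple.isAlmostFactorizable_iff [Fintype E] [Finite K] {k : ℕ}
    {G : HingeHypergraph V E K} (hG : G.IsSimple)
    (R : Fin k → ℕ) : G.IsAlmostFactorizable R ↔ ∃ c : E → Fin k, ∀ i v,
      (R i : ℤ) - 1 ≤ ((Finset.univ.filter fun e => c e = i ∧ v ∈ G.verts e).card : ℤ) ∧
        ((Finset.univ.filter fun e => c e = i ∧ v ∈ G.verts e).card : ℤ) ≤ R i := by
  constructor
  · rintro ⟨F, hdisj, hunion, hF⟩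
    have hmem : ∀ e, ∃ i, e ∈ F i := fun e =>
      Set.mem_iUnion.1 (hunion ▸ Set.mem_univ e)
    choose c hc using hmem
    have hci : ∀ e i, c e = i ↔ e ∈ F i := by
      intro e i
      refine ⟨fun h => h ▸ hc e, fun h => ?_⟩
      by_contra hne
      exact Set.disjoint_left.1 (hdisj hne) (hc e) h
    refine ⟨c, fun i v => ?_⟩
    simp only [hci]
    rw [← hG.degree_spanningSub]
    exact hF i v
  · rintro ⟨c, hc⟩
    refine ⟨fun i => {e | c e = i}, ?_, ?_, fun i v => ?_⟩
    · intro i i' hne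
      refine Set.disjoint_left.2 fun e (he : c e = i) (he' : c e = i') => hne ?_
      exact he.symm.trans he'
    · ext e
      simp
    · rw [hG.degree_spanningSub]
      simpa using hc i v

end HingeHypergraph

/-! ### The main theorem -/

theorem theorem6p4 {V E K : Type*} [Finite V] [Finite E] [Finite K]
    (G : HingeHypergraph V E K)
    (n k m : ℕ) (hn : 1 ≤ n)
    (R : Fin k → ℕ) (hR : ∀ i, 1 ≤ R i)
    (lam : Fin m → ℕ) (hlam : ∀ j, 1 ≤ lam j)
    (h : Fin m → ℕ) (hh : ∀ j, 1 ≤ h j ∧ h j ≤ n) (hinj : Function.Injective h)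
    (hG : G.IsLambdaK n lam h) :
    G.IsAlmostFactorizable R ↔
      ((∑ i, (R i : ℤ)) - (k : ℤ) ≤ ((∑ j, lam j * (n - 1).choose (h j - 1) : ℕ) : ℤ) ∧
        ((∑ j, lam j * (n - 1).choose (h j - 1) : ℕ) : ℤ) ≤ ∑ i, (R i : ℤ)) ∧
      ∃ A : Matrix (Fin k) (Fin m) ℕ,
        (∀ i, (n : ℤ) * ((R i : ℤ) - 1) ≤ ((A.mulVec h i : ℕ) : ℤ) ∧
          ((A.mulVec h i : ℕ) : ℤ) ≤ (n : ℤ) * (R i : ℤ)) ∧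
        ∀ j, ∑ i, A i j = lam j * n.choose (h j) := by
  classical
  have := Fintype.ofFinite V
  have := Fintype.ofFinite E
  have hcard : Fintype.card V = n := by
    rw [← Nat.card_eq_fintype_card, hG.card_vertices]
  have hsize : ∀ e, ∃ j, (G.verts e).card = h j := fun e => by
    rw [← G.size_eq_card_verts]
    exact hG.size_eq e
  have hmult : ∀ j (U : Finset V), U.card = h j →
      (Finset.univ.filter fun e => G.verts e = U).card = lam j := fun j U hU => by
    rw [← hG.simple.multiplicity_eq]
    exact hG.multiplicity_eq j U hU
  have hmulVec : ∀ (A : Matrix (Fin k) (Fin m) ℕ) i,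
      ((A.mulVec h i : ℕ) : ℤ) = ∑ j, (A i j : ℤ) * h j := by
    intro A i
    simp [Matrix.mulVec, dotProduct]
  rw [hG.simple.isAlmostFactorizable_iff R]
  simp only [hmulVec, mul_comm (n : ℤ)]
  constructor
  · rintro ⟨c, hc⟩
    have : Nonempty V := Fintype.card_pos_iff.1 (by omega)
    have := numerical_conditions_of_coloring G.verts lam h hinj (fun j => (hh j).1) hsize hmult
      (fun i => (R i : ℤ)) c hc
    rw [hcard, Fintype.card_fin] at this
    exact this
  · rintro ⟨-, A, hA, hcol⟩
    subst hcard
    exact exists_almost_regular_coloring G.verts lam h hinj hsize hmult (fun i => (R i : ℤ)) A hA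
      hcol
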